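/- **Theorem 3.2 (correctness of the 2-Chordal Bipartite Checker).** Let $G=(X,Y,E)$ be a finite bipartite graph ($X,Y$ disjoint finite vertex sets, every edge in $E$ joining a vertex of $X$ to a vertex of $Y$). Call $G$ *2-chordal bipartite* if every cycle of $G$ of length at least $6$ has at least two chords. In a finite simple graph $H$, write $N_H(v)$ for the open and $N_H[v]=N_H(v)\cup\{v\}$ for the closed neighborhood of a vertex $v$; a vertex $v$ is *simple* if its neighbors can be listed as $v_1,\dots,v_k$ with $N_H[v_1]\subseteq N_H[v_2]\subseteq\dots\subseteq N_H[v_k]$. Consider the following algorithm with input $G$. 1. *Check* the edge set $F=E$, as follows. Start with $H:=(X\cup Y,F)$ and add an edge between any two distinct vertices of $X$ (by a loop over $x\in X$ and, inside it, over the vertices of $X$ not yet treated). Set $\mathrm{flag}:=0$. While $H$ has a vertex and $\mathrm{flag}=0$: run through the vertices of the current $H$; as soon as a simple vertex of $H$ is met, delete it from $H$, set $\mathrm{flag}:=1$ if $H$ now has no vertex, and restart the while loop; if all vertices have been visited and none is simple, set $\mathrm{flag}:=2$. When the while loop has ended, return **False** if $\mathrm{flag}=2$. 2. For each edge $e\in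 E$ in turn, check the edge set $F=E\setminus\{e\}$ in the same way, returning **False** if $\mathrm{flag}=2$ at the end of that check. 3. Return **True**. All loops over finite sets may visit their elements in any order. Then for every finite bipartite graph $G$ the algorithm halts on $G$, whatever these orders are: no run is infinite, and every run ends by returning a value. It returns **True** if and only if $G$ is 2-chordal bipartite, and **False** if and only if $G$ is not 2-chordal bipartite. -/

import Mathlib

namespace TwoChordal

/-- A finite simple graph: a finite vertex set together with a finite set of unordered pairs of
distinct vertices. -/
structure FinGraph (V : Type*) where
  verts : Finset V
  edges : Finset (Sym2 V)
  incl : ∀ e ∈ edges, ∀ v ∈ e, v ∈ verts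
  loopless : ∀ e ∈ edges, ¬ e.IsDiag

namespace FinGraph

variable {V : Type*} [DecidableEq V]

/-- The graph obtained by adding the edge `{x, v}` to the edge set (a pair that is not a pair of
distinct vertices of the graph is ignored). -/
def addEdge (H : FinGraph V) (x v : V) : FinGraph V where
  verts := H.verts
  edges := if x ∈ H.verts ∧ v ∈ H.verts ∧ x ≠ v then insert s(x, v) H.edges else H.edges
  incl := by
    intro e he w hw
    split_ifs at he with h
    · rcases Finset.mem_insert.1 he with rfl | he
      · rcases Sym2.mem_iff.1 hw with rfl | rfl
        · exact h.1
        · exact h.2.1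
      · exact H.incl e he w hw
    · exact H.incl e he w hw
  loopless := by
    intro e he
    split_ifs at he with h
    · rcases Finset.mem_insert.1 he with rfl | he
      · simpa using h.2.2
      · exact H.loopless e he
    · exact H.loopless e he

/-- The graph obtained by deleting a vertex `v` and all edges containing `v`. -/
def delete (H : FinGraph V) (v : V) : FinGraph V where
  verts := H.verts.erase v
  edges := H.edges.filter fun e => v ∉ e
  incl := by
    intro e he w hw
    rw [Finset.mem_filter] at he
    refine Finset.mem_erase.2 ⟨?_, H.incl e he.1 w hw⟩
    rintro rfl
    exact he.2 hw
  loopless := fun e he => H.loopless e (Finset.mem_filter.1 he).1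

/-- The open neighborhood of `v`. -/
def nbhd (H : FinGraph V) (v : V) : Finset V :=
  H.verts.filter fun u => s(v, u) ∈ H.edges

/-- The closed neighborhood of `v`. -/
def closedNbhd (H : FinGraph V) (v : V) : Finset V :=
  insert v (H.nbhd v)

/-- The vertex `v` is simple: its neighbors can be listed as `v₁, …, vₖ`, without repetition, such
that the closed neighborhoods satisfy `N[v₁] ⊆ N[v₂] ⊆ … ⊆ N[vₖ]`. -/
def IsSimple (H : FinGraph V) (v : V) : Prop :=
  ∃ l : List V, l.Nodup ∧ l.toFinset = H.nbhd v ∧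
    l.Pairwise fun a b => H.closedNbhd a ⊆ H.closedNbhd b

end FinGraph

/-- A finite bipartite graph `G = (X, Y, E)`: two disjoint finite vertex sets, and a set of edges
each joining a vertex of `X` to a vertex of `Y`. -/
structure BiGraph (V : Type*) where
  X : Finset V
  Y : Finset V
  E : Finset (Sym2 V)
  disj : Disjoint X Y
  bip : ∀ e ∈ E, ∃ x ∈ X, ∃ y ∈ Y, e = s(x, y)

namespace BiGraph

variable {V : Type*} [DecidableEq V]

/-- The underlying graph `(X ∪ Y, E)`. -/
def forget (G : BiGraph V) : FinGraph V where
  verts := G.X ∪ G.Y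
  edges := G.E
  incl := by
    intro e he v hv
    obtain ⟨x, hx, y, hy, rfl⟩ := G.bip e he
    rcases Sym2.mem_iff.1 hv with rfl | rfl
    · exact Finset.mem_union_left _ hx
    · exact Finset.mem_union_right _ hy
  loopless := by
    intro e he h
    obtain ⟨x, hx, y, hy, rfl⟩ := G.bip e he
    have hxy : x = y := by simpa using h
    exact Finset.disjoint_left.1 G.disj hx (hxy ▸ hy)

/-- The bipartite graph `(X, Y, E - {e})`. -/
def deleteEdge (G : BiGraph V) (e : Sym2 V) : BiGraph V where
  X := G.X
  Y := G.Y
  E := G.E.erase e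
  disj := G.disj
  bip := fun f hf => G.bip f (Finset.mem_of_mem_erase hf)

/-- The bipartite graph viewed as a `SimpleGraph` on the ambient type. (Elements of the ambient
type outside `X ∪ Y` are isolated, so they lie on no cycle.) -/
def toSimpleGraph (G : BiGraph V) : SimpleGraph V :=
  SimpleGraph.fromEdgeSet (G.E : Set (Sym2 V))

/-- Every cycle of length at least 6 has at least two chords. -/
def IsTwoChordal (G : BiGraph V) : Prop :=
  ∀ (v : V) (c : G.toSimpleGraph.Walk v v), c.IsCycle → 6 ≤ c.length →
    ∃ e₁ e₂ : Sym2 V, e₁ ≠ e₂ ∧ c.IsChord e₁ ∧ c.IsChord e₂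

end BiGraph

/-- The block of instructions that glues `X` into a clique and then eliminates simple vertices
occurs twice in the algorithm: once for `G` itself (`main`), and once in the body of the loop
`for edge in E` (`edge rest`, where `rest` holds the edges that this loop has still to visit). -/
inductive Pass (V : Type*)
  | main : Pass V
  | edge (rest : Finset (Sym2 V)) : Pass V

/-- The configurations of the algorithm: the point that the execution has reached, with the current
values of the variables that are live there. A `for` loop over a finite set carries the set of
elements that it has still to visit. The variable `H` also plays the role of `H_e`. -/
inductive State (V : Type*)
  /-- The beginning. -/
  | start : State V
  /-- Head of the loop `for x in X`, with the elements `todo` of `X` still to visit. -/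
  | glueOuter (p : Pass V) (H : FinGraph V) (yetToGlue todo : Finset V) : State V
  /-- Head of the loop `for v in yetToGlue`, run for the vertex `x`, with the elements `inner` still
  to visit. -/
  | glueInner (p : Pass V) (H : FinGraph V) (yetToGlue todo : Finset V) (x : V)
      (inner : Finset V) : State V
  /-- Head of the loop `while H.vertices ≠ ∅ and flag == 0`. -/
  | whileHead (p : Pass V) (H : FinGraph V) (flag : ℕ) : State V
  /-- Head of the loop `for vertex in H.vertices`, with the vertices `todo` still to visit. -/
  | scan (p : Pass V) (H : FinGraph V) (flag : ℕ) (todo : Finset V) : State V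
  /-- The test `if flag == 2`. -/
  | test (p : Pass V) (flag : ℕ) : State V
  /-- Head of the loop `for edge in E`, with the edges `todo` still to visit. -/
  | edgeHead (todo : Finset (Sym2 V)) : State V
  /-- The algorithm has halted, returning `b`. -/
  | done (b : Bool) : State V

variable {V : Type*} [DecidableEq V]

/-- One step of the algorithm on the input `G`. A `for` loop may visit its set in any order, so the
next element is an arbitrary element of the set that is still to visit. -/
inductive Step (G : BiGraph V) : State V → State V → Prop
  /-- `H := graph(X ∪ Y, E)`, `yetToGlue := X`, and enter `for x in X`. -/
  | init : Step G .start (.glueOuter .main G.forget G.X G.X)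
  /-- `for x in X`: take the next `x`, `yetToGlue := yetToGlue - {x}`, and enter
  `for v in yetToGlue`. -/
  | glueNext {p H yet todo x} (hx : x ∈ todo) :
      Step G (.glueOuter p H yet todo)
        (.glueInner p H (yet.erase x) (todo.erase x) x (yet.erase x))
  /-- `for x in X` is over: `flag := 0`, and go to the `while` loop. -/
  | glueEnd {p H yet} : Step G (.glueOuter p H yet ∅) (.whileHead p H 0)
  /-- `for v in yetToGlue`: take the next `v` and add `{x, v}` to the edges of `H`. -/
  | glueAdd {p H yet todo x inner v} (hv : v ∈ inner) :
      Step G (.glueInner p H yet todo x inner)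
        (.glueInner p (H.addEdge x v) yet todo x (inner.erase v))
  /-- `for v in yetToGlue` is over. -/
  | glueAddEnd {p H yet todo x} :
      Step G (.glueInner p H yet todo x ∅) (.glueOuter p H yet todo)
  /-- The condition of the `while` loop holds: enter `for vertex in H.vertices`. -/
  | whileEnter {p H flag} (hH : H.verts ≠ ∅) (hf : flag = 0) :
      Step G (.whileHead p H flag) (.scan p H flag H.verts)
  /-- The condition of the `while` loop fails: leave the loop. -/
  | whileExit {p H flag} (h : ¬ (H.verts ≠ ∅ ∧ flag = 0)) :
      Step G (.whileHead p H flag) (.test p flag)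
  /-- The next vertex is simple: `H := H.delete(vertex)`, set `flag := 1` if `H` has no vertex
  left, and restart the `while` loop. -/
  | scanSimple {p H flag todo v} (hv : v ∈ todo) (hs : H.IsSimple v) :
      Step G (.scan p H flag todo)
        (.whileHead p (H.delete v) (if (H.delete v).verts = ∅ then 1 else flag))
  /-- The next vertex is not simple: go on. -/
  | scanNext {p H flag todo v} (hv : v ∈ todo) (hs : ¬ H.IsSimple v) :
      Step G (.scan p H flag todo) (.scan p H flag (todo.erase v))
  /-- `for vertex in H.vertices` is over: `flag := 2`. -/
  | scanEnd {p H flag} : Step G (.scan p H flag ∅) (.whileHead p H 2)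
  /-- `if flag == 2: return false`. -/
  | testFail {p flag} (hf : flag = 2) : Step G (.test p flag) (.done false)
  /-- `flag` is not 2 after the first elimination: enter `for edge in E`. -/
  | testMain {flag} (hf : flag ≠ 2) : Step G (.test .main flag) (.edgeHead G.E)
  /-- `flag` is not 2 in the body of `for edge in E`: go back to the head of that loop. -/
  | testEdge {rest flag} (hf : flag ≠ 2) : Step G (.test (.edge rest) flag) (.edgeHead rest)
  /-- `for edge in E`: take the next edge `e`, `H_e := graph(X ∪ Y, E - {e})`, `yetToGlue := X`,
  and enter `for x in X`. -/
  | edgeNext {todo e} (he : e ∈ todo) :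
      Step G (.edgeHead todo)
        (.glueOuter (.edge (todo.erase e)) (G.deleteEdge e).forget G.X G.X)
  /-- `for edge in E` is over: `return True`. -/
  | edgeEnd : Step G (.edgeHead ∅) (.done true)

/-- The configuration `s` occurs in some run of the algorithm on the input `G`. -/
def Reachable (G : BiGraph V) (s : State V) : Prop :=
  Relation.ReflTransGen (Step G) .start s

/-- The algorithm halts on the input `G`, whatever the order in which the `for` loops visit their
sets: no run is infinite, and a run that cannot be continued has returned a value. -/
def Halts (G : BiGraph V) : Prop :=
  (¬ ∃ r : ℕ → State V, r 0 = .start ∧ ∀ n, Step G (r n) (r (n + 1))) ∧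
    ∀ s, Reachable G s → (∀ t, ¬ Step G s t) → ∃ b, s = .done b

/-- Some run of the algorithm on the input `G` returns the value `b`. -/
def Returns (G : BiGraph V) (b : Bool) : Prop :=
  Reachable G (.done b)

end TwoChordal

/-! Two chords reduce to one: a cycle of length at least 6 with chord `e` is still a cycle after `e`
is deleted, and a chord it has there is a second chord. So `G` is 2-chordal bipartite exactly when
`G` and every `G - e` have a chord in each cycle of length at least 6 (`isTwoChordal_iff`). It
remains to see that one check decides this one-chord property.

Suppose the property holds. As long as vertices of `Y` remain, order the biadjacency matrix between
the remaining `Y` and the remaining `X` doubly lexically. If two columns meeting the first row were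
not nested, the ordering would force a chordless path that grows at both ends until it closes into a
long chordless cycle (`Staircase.extend`). Hence the first row is a vertex of `Y` whose neighbors
have nested neighborhoods, and with `X` a clique it is simple. Once `Y` is exhausted, the graph is a
clique and every vertex is simple. Thus elimination never gets stuck, whichever simple vertices are
deleted.

Conversely, no vertex of a long chordless cycle is simple while the whole cycle is present, so the
cycle is never destroyed and elimination gets stuck.

The nondeterministic program is handled by `RunsTo`, which says that all runs from a configuration
terminate with the same value. -/

namespace TwoChordal

/-! ### Doubly lexical orderings of matrices. -/

open Finset in
/-- If no permutation increases `∑ 2 ^ k * w k`, then `w` is monotone. -/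
theorem monotone_of_forall_sum_perm_le {n : ℕ} (w : Fin n → ℕ)
    (h : ∀ π : Equiv.Perm (Fin n), ∑ k : Fin n, 2 ^ (k : ℕ) * w (π k) ≤ ∑ k : Fin n, 2 ^ (k : ℕ) * w k) :
    Monotone w := by
  intro i j hij
  by_contra! hlt
  have hne : i ≠ j := by rintro rfl; exact lt_irrefl _ hlt
  have hij' : (i : ℕ) < j := lt_of_le_of_ne hij (fun e => hne (Fin.ext e))
  have hpow : 2 ^ (i : ℕ) < 2 ^ (j : ℕ) := Nat.pow_lt_pow_right (by norm_num) hij'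
  -- Removing the inversion raises the sum by `(2 ^ j - 2 ^ i) * (w i - w j) > 0`.
  have hs := h (Equiv.swap i j)
  have hj : j ∈ (univ : Finset (Fin n)).erase i := by simp [hne.symm]
  rw [← add_sum_erase _ _ (mem_univ i), ← add_sum_erase _ _ hj,
    ← add_sum_erase univ (fun k : Fin n => 2 ^ (k : ℕ) * w k) (mem_univ i),
    ← add_sum_erase _ (fun k : Fin n => 2 ^ (k : ℕ) * w k) hj] at hs
  have hrest : ∑ k ∈ (univ.erase i).erase j, 2 ^ (k : ℕ) * w (Equiv.swap i j k) =
      ∑ k ∈ (univ.erase i).erase j, 2 ^ (k : ℕ) * w k := by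
    refine sum_congr rfl fun k hk => ?_
    simp only [mem_erase, mem_univ, and_true] at hk
    rw [Equiv.swap_apply_of_ne_of_ne hk.2 hk.1]
  rw [hrest] at hs
  simp only [Equiv.swap_apply_left, Equiv.swap_apply_right] at hs
  nlinarith

/-- The rows of `M` are ordered lexicographically, the last column being the most significant. -/
def LexRows {a b : ℕ} (M : Fin a → Fin b → Prop) : Prop :=
  ∀ i i' j, i < i' → M i j → ¬ M i' j →
    ∃ k, j < k ∧ M i' k ∧ ¬ M i k ∧ ∀ l, k < l → (M i l ↔ M i' l)

-- Each row is read as a binary number whose last column is the leading digit. Numerical order of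
-- binary numbers is lexicographic order of their digits, here in the form of the colexicographic
-- order on finsets.
open Finset in
open scoped Classical in
theorem lexRows_of_monotone {a b : ℕ} (M : Fin a → Fin b → Prop)
    (h : Monotone fun i => ∑ j : Fin b, if M i j then 2 ^ (j : ℕ) else 0) : LexRows M := by
  intro i i' j hii hj hj'
  let s (i : Fin a) : Finset ℕ := (univ.filter fun j => M i j).map Fin.valEmbedding
  have hmem : ∀ (i : Fin a) (j : Fin b), (j : ℕ) ∈ s i ↔ M i j := by
    intro i j
    simp [s, Fin.ext_iff.symm]
  have hle := h hii.le
  have hw : ∀ i, (∑ j : Fin b, if M i j then 2 ^ (j : ℕ) else 0) = ∑ k ∈ s i, 2 ^ k := by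
    intro i
    simp [s, sum_filter]
  simp only [hw] at hle
  rw [geomSum_le_geomSum_iff_toColex_le_toColex le_rfl] at hle
  have hne : s i ≠ s i' := fun e => hj' ((hmem _ _).1 (e ▸ (hmem _ _).2 hj))
  have hlt := lt_of_le_of_ne hle (fun e => hne (toColex_inj.1 e))
  obtain ⟨k, hk, hf⟩ := Colex.lt_iff_exists_filter_lt.1 hlt
  obtain ⟨hk1, hk2⟩ := mem_sdiff.1 hk
  obtain ⟨k, -, rfl⟩ := mem_map.1 hk1
  have hk1 := (hmem i' k).1 hk1
  have hk2 := mt (hmem i k).2 hk2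
  have hl : ∀ l, k < l → (M i l ↔ M i' l) := by
    intro l hl
    have := Finset.ext_iff.1 hf (l : ℕ)
    simp only [mem_filter, hmem] at this
    have hl' : Fin.valEmbedding k < (l : ℕ) := hl
    tauto
  refine ⟨k, ?_, hk1, hk2, hl⟩
  rcases lt_trichotomy j k with h | h | h
  · exact h
  · subst h; exact absurd hj hk2
  · exact absurd ((hl j h).1 hj) hj'

/-- Every matrix has a doubly lexical ordering. -/
theorem exists_doubly_lex {a b : ℕ} (M : Fin a → Fin b → Prop) :
    ∃ (σ : Equiv.Perm (Fin a)) (τ : Equiv.Perm (Fin b)),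
      LexRows (fun i j => M (σ i) (τ j)) ∧ LexRows (fun j i => M (σ i) (τ j)) := by
  classical
  -- A true entry at position `(i, j)` weighs `2 ^ (i + j)`. Grouped by rows, this is the sum of `2
  -- ^ i` times the binary value of row `i`; grouped by columns, it has the same shape. So a single
  -- maximizer sorts both.
  let Φ (p : Equiv.Perm (Fin a) × Equiv.Perm (Fin b)) : ℕ :=
    ∑ i : Fin a, ∑ j : Fin b, 2 ^ (i : ℕ) * if M (p.1 i) (p.2 j) then 2 ^ (j : ℕ) else 0
  obtain ⟨⟨σ, τ⟩, hmax⟩ := Finite.exists_max Φ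
  have hswap : ∀ p, Φ p = ∑ j : Fin b, 2 ^ (j : ℕ) *
      ∑ i : Fin a, if M (p.1 i) (p.2 j) then 2 ^ (i : ℕ) else 0 := by
    intro p
    simp only [Φ]
    rw [Finset.sum_comm]
    refine Finset.sum_congr rfl fun j _ => ?_
    rw [Finset.mul_sum]
    refine Finset.sum_congr rfl fun i _ => ?_
    split_ifs
    · exact mul_comm _ _
    · rfl
  refine ⟨σ, τ, lexRows_of_monotone _ (monotone_of_forall_sum_perm_le _ fun π => ?_),
    lexRows_of_monotone _ (monotone_of_forall_sum_perm_le _ fun π => ?_)⟩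
  · have : Φ (π.trans σ, τ) ≤ Φ (σ, τ) := hmax _
    simp only [Φ, Equiv.trans_apply, ← Finset.mul_sum] at this
    exact this
  · have : Φ (σ, π.trans τ) ≤ Φ (σ, τ) := hmax _
    rw [hswap, hswap] at this
    simp only [Equiv.trans_apply] at this
    exact this

/-! ### Growing a chordless cycle in a doubly lexically ordered matrix. -/

/-- The first rows and columns of a chordless cycle that is not yet closed up. -/
structure Staircase {a b : ℕ} (M : Fin a → Fin b → Prop) (r : ℕ → Fin a) (c : ℕ → Fin b)
    (n : ℕ) : Prop where
  row_lt : ∀ i j, i < j → j ≤ n → r i < r j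
  col_lt : ∀ i j, i < j → j ≤ n → c i < c j
  iff : ∀ i j, i ≤ n → j ≤ n → (M (r i) (c j) ↔ (i = 0 ∧ j = 0) ∨ i = j + 1 ∨ j = i + 1)
  row_agree : ∀ i l, i < n → c n < l → (M (r i) l ↔ M (r (n - 1)) l)
  col_agree : ∀ j l, j < n → r n < l → (M l (c j) ↔ M l (c (n - 1)))

/-- Rows and columns that form a chordless cycle of length `2 * N + 2`. -/
structure ChordlessCycle {R C : Type*} (M : R → C → Prop) (r : ℕ → R) (c : ℕ → C)
    (N : ℕ) : Prop where
  row_inj : ∀ i j, i ≤ N → j ≤ N → r i = r j → i = j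
  col_inj : ∀ i j, i ≤ N → j ≤ N → c i = c j → i = j
  iff : ∀ i j, i ≤ N → j ≤ N →
    (M (r i) (c j) ↔ (i = 0 ∧ j = 0) ∨ (i = N ∧ j = N) ∨ i = j + 1 ∨ j = i + 1)

/-- The staircase is a chordless path with ends `r n` and `c n`. Row `n - 1` beats row `n` in column
`c n`, so lexicographic order yields a later column `y` where row `n` wins, with agreement beyond
it; symmetrically for a later row `x`. The path grows by `y` and `x`, and it closes into a cycle
exactly when `M x y` holds. -/
theorem Staircase.extend {a b : ℕ} {M : Fin a → Fin b → Prop} (hr : LexRows M)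
    (hc : LexRows fun j i => M i j) {r : ℕ → Fin a} {c : ℕ → Fin b} {n : ℕ} (hn : 1 ≤ n)
    (h : Staircase M r c n) :
    (∃ r c, ChordlessCycle M r c (n + 1)) ∨ ∃ r c, Staircase M r c (n + 1) := by
  obtain ⟨m, rfl⟩ : ∃ m, n = m + 1 := ⟨n - 1, by omega⟩
  have hfalse : ¬ M (r (m + 1)) (c (m + 1)) := by rw [h.iff _ _ le_rfl le_rfl]; omega
  obtain ⟨y, hy, hy1, hy2, hy3⟩ := hr (r m) (r (m + 1)) (c (m + 1)) (h.row_lt _ _ (by omega) le_rfl)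
    ((h.iff _ _ (by omega) le_rfl).2 (by omega)) hfalse
  obtain ⟨x, hx, hx1, hx2, hx3⟩ := hc (c m) (c (m + 1)) (r (m + 1)) (h.col_lt _ _ (by omega) le_rfl)
    ((h.iff _ _ le_rfl (by omega)).2 (by omega)) hfalse
  -- The agreement clauses carry the absence of an entry at `y` back from row `m` to all earlier
  -- rows, so the new vertices create no chord with the old path.
  have hrowy : ∀ i ≤ m, ¬ M (r i) y := fun i hi => by
    rw [h.row_agree i y (by omega) hy]; exact hy2
  have hcolx : ∀ j ≤ m, ¬ M x (c j) := fun j hj => by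
    rw [h.col_agree j x (by omega) hx]; exact hx2
  let r' : ℕ → Fin a := fun i => if i ≤ m + 1 then r i else x
  let c' : ℕ → Fin b := fun i => if i ≤ m + 1 then c i else y
  have hr' : ∀ i ≤ m + 1, r' i = r i := fun i hi => if_pos hi
  have hc' : ∀ i ≤ m + 1, c' i = c i := fun i hi => if_pos hi
  have hrx : r' (m + 2) = x := if_neg (by omega)
  have hcy : c' (m + 2) = y := if_neg (by omega)
  have hrl : ∀ i j, i < j → j ≤ m + 2 → r' i < r' j := by
    intro i j hij hj
    rcases Nat.lt_or_ge j (m + 2) with hj' | hj'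
    · rw [hr' i (by omega), hr' j (by omega)]; exact h.row_lt _ _ hij (by omega)
    · obtain rfl : j = m + 2 := by omega
      rw [hr' i (by omega), hrx]
      rcases Nat.lt_or_ge i (m + 1) with hi | hi
      · exact (h.row_lt _ _ hi le_rfl).trans hx
      · obtain rfl : i = m + 1 := by omega
        exact hx
  have hcl : ∀ i j, i < j → j ≤ m + 2 → c' i < c' j := by
    intro i j hij hj
    rcases Nat.lt_or_ge j (m + 2) with hj' | hj'
    · rw [hc' i (by omega), hc' j (by omega)]; exact h.col_lt _ _ hij (by omega)
    · obtain rfl : j = m + 2 := by omega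
      rw [hc' i (by omega), hcy]
      rcases Nat.lt_or_ge i (m + 1) with hi | hi
      · exact (h.col_lt _ _ hi le_rfl).trans hy
      · obtain rfl : i = m + 1 := by omega
        exact hy
  -- Everything except the new corner `M x y` is now determined.
  have hiff : ∀ i j, i ≤ m + 2 → j ≤ m + 2 → ¬ (i = m + 2 ∧ j = m + 2) →
      (M (r' i) (c' j) ↔ (i = 0 ∧ j = 0) ∨ i = j + 1 ∨ j = i + 1) := by
    intro i j hi hj hij
    rcases Nat.lt_or_ge i (m + 2) with hi' | hi'
    · rw [hr' i (by omega)]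
      rcases Nat.lt_or_ge j (m + 2) with hj' | hj'
      · rw [hc' j (by omega)]; exact h.iff i j (by omega) (by omega)
      · obtain rfl : j = m + 2 := by omega
        rw [hcy]
        rcases Nat.lt_or_ge i (m + 1) with hi'' | hi''
        · exact iff_of_false (hrowy i (by omega)) (by omega)
        · obtain rfl : i = m + 1 := by omega
          exact iff_of_true hy1 (by omega)
    · obtain rfl : i = m + 2 := by omega
      rw [hrx, hc' j (by omega)]
      rcases Nat.lt_or_ge j (m + 1) with hj'' | hj''
      · exact iff_of_false (hcolx j (by omega)) (by omega)
      · obtain rfl : j = m + 1 := by omega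
        exact iff_of_true hx1 (by omega)
  by_cases hxy : M x y
  · left
    refine ⟨r', c', fun i j hi hj e => ?_, fun i j hi hj e => ?_, fun i j hi hj => ?_⟩
    · rcases lt_trichotomy i j with hlt | hlt | hlt
      · exact absurd e (hrl _ _ hlt hj).ne
      · exact hlt
      · exact absurd e (hrl _ _ hlt hi).ne'
    · rcases lt_trichotomy i j with hlt | hlt | hlt
      · exact absurd e (hcl _ _ hlt hj).ne
      · exact hlt
      · exact absurd e (hcl _ _ hlt hi).ne'
    · by_cases hij : i = m + 2 ∧ j = m + 2
      · obtain ⟨rfl, rfl⟩ := hij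
        rw [hrx, hcy]
        exact iff_of_true hxy (by omega)
      · rw [hiff i j hi hj hij]; omega
  · right
    refine ⟨r', c', hrl, hcl, fun i j hi hj => ?_, fun i l hi hl => ?_, fun j l hj hl => ?_⟩
    · by_cases hij : i = m + 2 ∧ j = m + 2
      · obtain ⟨rfl, rfl⟩ := hij
        rw [hrx, hcy]
        exact iff_of_false hxy (by omega)
      · exact hiff i j hi hj hij
    · change c' (m + 2) < l at hl
      change _ ↔ M (r' (m + 1)) l
      rw [hcy] at hl
      rw [hr' i (by omega), hr' _ le_rfl]
      rcases Nat.lt_or_ge i (m + 1) with hi' | hi'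
      · exact (h.row_agree i l hi' (hy.trans hl)).trans (hy3 l hl)
      · obtain rfl : i = m + 1 := by omega
        rfl
    · change r' (m + 2) < l at hl
      change _ ↔ M l (c' (m + 1))
      rw [hrx] at hl
      rw [hc' j (by omega), hc' _ le_rfl]
      rcases Nat.lt_or_ge j (m + 1) with hj' | hj'
      · exact (h.col_agree j l hj' (hx.trans hl)).trans (hx3 l hl)
      · obtain rfl : j = m + 1 := by omega
        rfl

theorem Staircase.exists_chordlessCycle {a b : ℕ} {M : Fin a → Fin b → Prop} (hr : LexRows M)
    (hc : LexRows fun j i => M i j) {r : ℕ → Fin a} {c : ℕ → Fin b} (h : Staircase M r c 1) :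
    ∃ N r c, 2 ≤ N ∧ ChordlessCycle M r c N := by
  by_contra! hno
  have key : ∀ n, ∃ r c, Staircase M r c (n + 1) := by
    intro n
    induction n with
    | zero => exact ⟨r, c, h⟩
    | succ n ih =>
      obtain ⟨r, c, h⟩ := ih
      rcases h.extend hr hc (by omega) with ⟨r, c, h⟩ | h
      · exact absurd h (hno _ _ _ (by omega))
      · exact h
  -- A staircase of this size has more than `a` strictly increasing rows in `Fin a`.
  obtain ⟨r, c, h⟩ := key a
  have hinj : Function.Injective fun i : Fin (a + 1) => r i := by
    intro i j e
    rcases lt_trichotomy i j with hlt | hlt | hlt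
    · exact absurd e (h.row_lt _ _ hlt (by omega)).ne
    · exact hlt
    · exact absurd e (h.row_lt _ _ hlt (by omega)).ne'
  simpa using Fintype.card_le_of_injective _ hinj

/-- In a matrix without chordless cycles of length at least 6, the columns that contain some
row form a chain. -/
theorem exists_nest_row {R C : Type*} [Finite R] [Finite C] [Nonempty R] (M : R → C → Prop)
    (h : ∀ N r c, 2 ≤ N → ¬ ChordlessCycle M r c N) :
    ∃ r, ∀ c c', M r c → M r c' → (∀ r', M r' c → M r' c') ∨ ∀ r', M r' c' → M r' c := by
  obtain ⟨a, ⟨e⟩⟩ := Finite.exists_equiv_fin R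
  obtain ⟨b, ⟨f⟩⟩ := Finite.exists_equiv_fin C
  obtain ⟨σ, τ, hr, hc⟩ := exists_doubly_lex fun i j => M (e.symm i) (f.symm j)
  let e' : Fin a ≃ R := σ.trans e.symm
  let f' : Fin b ≃ C := τ.trans f.symm
  change LexRows fun i j => M (e' i) (f' j) at hr
  change LexRows fun j i => M (e' i) (f' j) at hc
  have ha : 0 < a := Fin.pos (e (Classical.arbitrary R))
  -- The first row works: a row `i` violating the nesting of columns `j < j'` comes after it, and
  -- rows `0, i` with columns `j, j'` have the single false entry at the lower right, which is the
  -- smallest staircase.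
  have key : ∀ j j', j < j' → M (e' ⟨0, ha⟩) (f' j) → M (e' ⟨0, ha⟩) (f' j') →
      ∀ i, M (e' i) (f' j) → M (e' i) (f' j') := by
    intro j j' hjj h1 h2 i h3
    by_contra h4
    have hi : (⟨0, ha⟩ : Fin a) < i := by
      refine lt_of_le_of_ne (Fin.mk_le_of_le_val (Nat.zero_le _)) ?_
      rintro rfl
      exact h4 h2
    have hs : Staircase (fun i j => M (e' i) (f' j)) (fun k => if k = 0 then ⟨0, ha⟩ else i)
        (fun k => if k = 0 then j else j') 1 := by
      refine ⟨fun k l hkl hl => ?_, fun k l hkl hl => ?_, fun k l hk hl => ?_,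
        fun k l hk _ => ?_, fun k l hk _ => ?_⟩
      · obtain rfl : k = 0 := by omega
        obtain rfl : l = 1 := by omega
        simpa using hi
      · obtain rfl : k = 0 := by omega
        obtain rfl : l = 1 := by omega
        simpa using hjj
      · interval_cases k <;> interval_cases l <;> simpa
      · obtain rfl : k = 0 := by omega
        rfl
      · obtain rfl : k = 0 := by omega
        rfl
    obtain ⟨N, r, c, hN, hC⟩ := hs.exists_chordlessCycle hr hc
    exact h N (fun i => e' (r i)) (fun j => f' (c j)) hN
      ⟨fun i j hi hj hij => hC.row_inj i j hi hj (e'.injective hij),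
        fun i j hi hj hij => hC.col_inj i j hi hj (f'.injective hij), hC.iff⟩
  refine ⟨e' ⟨0, ha⟩, fun c c' h1 h2 => ?_⟩
  obtain ⟨j, rfl⟩ := f'.surjective c
  obtain ⟨j', rfl⟩ := f'.surjective c'
  rcases lt_trichotomy j j' with hlt | rfl | hlt
  · left
    intro r'
    obtain ⟨i, rfl⟩ := e'.surjective r'
    exact key j j' hlt h1 h2 i
  · exact Or.inl fun _ => id
  · right
    intro r'
    obtain ⟨i, rfl⟩ := e'.surjective r'
    exact key j' j hlt h2 h1 i

end TwoChordal

/-! ### Long cycles and their chords in graphs. -/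

namespace TwoChordal

open SimpleGraph

theorem exists_isPath_of_injOn {V : Type*} {G : SimpleGraph V} (f : ℕ → V) (n : ℕ)
    (hadj : ∀ i < n, G.Adj (f i) (f (i + 1))) (hinj : ∀ i j, i ≤ n → j ≤ n → f i = f j → i = j) :
    ∃ p : G.Walk (f 0) (f n), p.IsPath ∧ p.length = n ∧ (∀ v ∈ p.support, ∃ i ≤ n, v = f i) ∧
      ∀ e, e ∈ p.edges ↔ ∃ i < n, e = s(f i, f (i + 1)) := by
  induction n with
  | zero => exact ⟨.nil, by simp⟩
  | succ n ih =>
    obtain ⟨p, hp, hl, hs, he⟩ := ih (fun i hi => hadj i (by omega))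
      (fun i j hi hj => hinj i j (by omega) (by omega))
    refine ⟨p.concat (hadj n (by omega)), ?_, by simp [hl], fun v hv => ?_, fun e => ?_⟩
    · refine hp.concat (fun h => ?_) _
      obtain ⟨i, hi, e⟩ := hs _ h
      have := hinj _ _ le_rfl (by omega) e
      omega
    · rw [Walk.support_concat, List.mem_append] at hv
      rcases hv with hv | hv
      · obtain ⟨i, hi, e⟩ := hs v hv
        exact ⟨i, by omega, e⟩
      · exact ⟨n + 1, le_rfl, by simpa using hv⟩
    · rw [Walk.edges_concat, List.concat_eq_append, List.mem_append, he]
      constructor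
      · rintro (⟨i, hi, h⟩ | h)
        · exact ⟨i, by omega, h⟩
        · exact ⟨n, by omega, by simpa using h⟩
      · rintro ⟨i, hi, h⟩
        rcases Nat.lt_or_ge i n with hi' | hi'
        · exact Or.inl ⟨i, hi', h⟩
        · obtain rfl : i = n := by omega
          exact Or.inr (by simpa using h)

/-- Every cycle of length at least 6 has a chord. -/
def CyclesHaveChord {V : Type*} (G : SimpleGraph V) : Prop :=
  ∀ (v : V) (c : G.Walk v v), c.IsCycle → 6 ≤ c.length → ∃ e, c.IsChord e

/-- Turns chords of walks into arithmetic on indices. The cycle has `n + 1` vertices, hence the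
bound `5 ≤ n`. -/
theorem CyclesHaveChord.exists_adj {V : Type*} {G : SimpleGraph V} (h : CyclesHaveChord G)
    (f : ℕ → V) (n : ℕ) (hn : 5 ≤ n) (hadj : ∀ i < n, G.Adj (f i) (f (i + 1)))
    (hclose : G.Adj (f n) (f 0)) (hinj : ∀ i j, i ≤ n → j ≤ n → f i = f j → i = j) :
    ∃ i j, i ≤ n ∧ j ≤ n ∧ G.Adj (f i) (f j) ∧ j ≠ i + 1 ∧ i ≠ j + 1 ∧ ¬ (i = 0 ∧ j = n) ∧
      ¬ (i = n ∧ j = 0) := by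
  obtain ⟨p, hp, hl, hs, he⟩ := exists_isPath_of_injOn f n hadj hinj
  have hcyc : (Walk.cons hclose p).IsCycle := by
    rw [Walk.cons_isCycle_iff]
    refine ⟨hp, fun hm => ?_⟩
    obtain ⟨i, hi, e⟩ := (he _).1 hm
    rcases Sym2.eq_iff.1 e with ⟨h1, h2⟩ | ⟨h1, h2⟩
    · have := hinj _ _ le_rfl (by omega) h1
      omega
    · have := hinj _ _ le_rfl (by omega) h1
      have := hinj _ _ (by omega) (by omega) h2
      omega
  obtain ⟨e, hc⟩ := h _ _ hcyc (by simp [hl]; omega)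
  induction e with | _ u w
  rw [Walk.isChord_sym2Mk] at hc
  obtain ⟨ha, hne, hu, hw⟩ := hc
  have hsup : ∀ v ∈ (Walk.cons hclose p).support, ∃ i ≤ n, v = f i := by
    intro v hv
    rw [Walk.support_cons, List.mem_cons] at hv
    rcases hv with rfl | hv
    · exact ⟨n, le_rfl, rfl⟩
    · exact hs v hv
  obtain ⟨i, hi, rfl⟩ := hsup u hu
  obtain ⟨j, hj, rfl⟩ := hsup w hw
  rw [Walk.edges_cons, List.mem_cons, not_or, he] at hne
  obtain ⟨hne1, hne2⟩ := hne
  refine ⟨i, j, hi, hj, ha, ?_, ?_, ?_, ?_⟩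
  · rintro rfl
    exact hne2 ⟨i, by omega, rfl⟩
  · rintro rfl
    exact hne2 ⟨j, by omega, Sym2.eq_swap⟩
  · rintro ⟨rfl, rfl⟩
    exact hne1 Sym2.eq_swap
  · rintro ⟨rfl, rfl⟩
    exact hne1 rfl

/-- A chordless cycle of the biadjacency relation contradicts `CyclesHaveChord`. -/
theorem CyclesHaveChord.not_chordlessCycle {V : Type*} {G : SimpleGraph V}
    (h : CyclesHaveChord G) {R C : Set V} (hdisj : Disjoint R C)
    (hR : ∀ u ∈ R, ∀ v ∈ R, ¬ G.Adj u v) (hC : ∀ u ∈ C, ∀ v ∈ C, ¬ G.Adj u v)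
    {N : ℕ} (hN : 2 ≤ N) {r : ℕ → R} {c : ℕ → C}
    (hcyc : ChordlessCycle (fun (u : R) (v : C) => G.Adj u v) r c N) : False := by
  -- The two interleaved halves `r 0, c 1, r 2, …` and `c 0, r 1, c 2, …` are induced paths, joined
  -- only at their first and at their last vertices. Below, `f` runs down `A` and then up `B`.
  let A (i : ℕ) : V := if i % 2 = 0 then r i else c i
  let B (i : ℕ) : V := if i % 2 = 0 then c i else r i
  have hne : ∀ i j, (r i : V) ≠ c j := fun i j e =>
    Set.disjoint_left.1 hdisj (r i).2 (e ▸ (c j).2)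
  have hiff : ∀ i j, i ≤ N → j ≤ N → (G.Adj (r i) (c j) ↔
      (i = 0 ∧ j = 0) ∨ (i = N ∧ j = N) ∨ i = j + 1 ∨ j = i + 1) := hcyc.iff
  have hr : ∀ i j, i ≤ N → j ≤ N → (r i : V) = r j → i = j :=
    fun i j hi hj e => hcyc.row_inj i j hi hj (Subtype.ext e)
  have hc : ∀ i j, i ≤ N → j ≤ N → (c i : V) = c j → i = j :=
    fun i j hi hj e => hcyc.col_inj i j hi hj (Subtype.ext e)
  have hrr : ∀ i j, ¬ G.Adj (r i) (r j) := fun i j => hR _ (r i).2 _ (r j).2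
  have hcc : ∀ i j, ¬ G.Adj (c i) (c j) := fun i j => hC _ (c i).2 _ (c j).2
  have hAA : ∀ i j, i ≤ N → j ≤ N → (G.Adj (A i) (A j) ↔ i = j + 1 ∨ j = i + 1) := by
    intro i j hi hj
    simp only [A]
    split_ifs with h1 h2 h2
    · exact iff_of_false (hrr _ _) (by omega)
    · rw [hiff _ _ hi hj]; omega
    · rw [G.adj_comm, hiff _ _ hj hi]; omega
    · exact iff_of_false (hcc _ _) (by omega)
  have hBB : ∀ i j, i ≤ N → j ≤ N → (G.Adj (B i) (B j) ↔ i = j + 1 ∨ j = i + 1) := by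
    intro i j hi hj
    simp only [B]
    split_ifs with h1 h2 h2
    · exact iff_of_false (hcc _ _) (by omega)
    · rw [G.adj_comm, hiff _ _ hj hi]; omega
    · rw [hiff _ _ hi hj]; omega
    · exact iff_of_false (hrr _ _) (by omega)
  have hAB : ∀ i j, i ≤ N → j ≤ N →
      (G.Adj (A i) (B j) ↔ (i = 0 ∧ j = 0) ∨ (i = N ∧ j = N)) := by
    intro i j hi hj
    simp only [A, B]
    split_ifs with h1 h2 h2
    · rw [hiff _ _ hi hj]; omega
    · exact iff_of_false (hrr _ _) (by omega)
    · exact iff_of_false (hcc _ _) (by omega)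
    · rw [G.adj_comm, hiff _ _ hj hi]; omega
  have hA : ∀ i j, i ≤ N → j ≤ N → A i = A j → i = j := by
    intro i j hi hj
    simp only [A]
    split_ifs with h1 h2 h2
    · exact hr _ _ hi hj
    · exact fun e => absurd e (hne _ _)
    · exact fun e => absurd e.symm (hne _ _)
    · exact hc _ _ hi hj
  have hB : ∀ i j, i ≤ N → j ≤ N → B i = B j → i = j := by
    intro i j hi hj
    simp only [B]
    split_ifs with h1 h2 h2
    · exact hc _ _ hi hj
    · exact fun e => absurd e.symm (hne _ _)
    · exact fun e => absurd e (hne _ _)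
    · exact hr _ _ hi hj
  have hABne : ∀ i j, i ≤ N → j ≤ N → A i ≠ B j := by
    intro i j hi hj
    simp only [A, B]
    split_ifs with h1 h2 h2
    · exact hne _ _
    · exact fun e => absurd (hr _ _ hi hj e) (by omega)
    · exact fun e => absurd (hc _ _ hi hj e) (by omega)
    · exact (hne _ _).symm
  let f (k : ℕ) : V := if k ≤ N then A (N - k) else B (k - (N + 1))
  obtain ⟨i, j, hi, hj, hadj, h1, h2, h3, h4⟩ := h.exists_adj f (2 * N + 1) (by omega)
    (fun i hi => by
      simp only [f]
      split_ifs with h1 h2 h2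
      · rw [hAA _ _ (by omega) (by omega)]; omega
      · rw [hAB _ _ (by omega) (by omega)]; omega
      · omega
      · rw [hBB _ _ (by omega) (by omega)]; omega)
    (by
      simp only [f]
      rw [if_neg (by omega), if_pos (by omega), G.adj_comm, hAB _ _ (by omega) (by omega)]
      omega)
    (fun i j hi hj => by
      simp only [f]
      split_ifs with h1 h2 h2
      · exact fun e => by have := hA _ _ (by omega) (by omega) e; omega
      · exact fun e => absurd e (hABne _ _ (by omega) (by omega))
      · exact fun e => absurd e.symm (hABne _ _ (by omega) (by omega))
      · exact fun e => by have := hB _ _ (by omega) (by omega) e; omega)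
  simp only [f] at hadj
  split_ifs at hadj with h1 h2 h2
  · rw [hAA _ _ (by omega) (by omega)] at hadj; omega
  · rw [hAB _ _ (by omega) (by omega)] at hadj; omega
  · rw [G.adj_comm, hAB _ _ (by omega) (by omega)] at hadj; omega
  · rw [hBB _ _ (by omega) (by omega)] at hadj; omega

/-- Around every vertex of a chordless cycle of length at least 6 there is an induced path
`y₁, x₁, u, x₂, y₂` of vertices of the cycle. -/
theorem exists_induced_path_of_chordless {V : Type*} [DecidableEq V] {G : SimpleGraph V} {v : V}
    {c : G.Walk v v} (hc : c.IsCycle) (hlen : 6 ≤ c.length) (hch : ∀ e, ¬ c.IsChord e) {u : V}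
    (hu : u ∈ c.support) :
    ∃ y₁ ∈ c.support, ∃ x₁ ∈ c.support, ∃ x₂ ∈ c.support, ∃ y₂ ∈ c.support,
      x₁ ≠ x₂ ∧ G.Adj u x₁ ∧ G.Adj u x₂ ∧ G.Adj x₁ y₁ ∧ G.Adj x₂ y₂ ∧
      ¬ G.Adj x₂ y₁ ∧ ¬ G.Adj x₁ y₂ := by
  let d := c.rotate u hu
  have hd : d.IsCycle := hc.rotate hu
  have hdl : d.length = c.length := c.length_rotate u hu
  have hmem : ∀ i, d.getVert i ∈ c.support := fun i =>
    (c.mem_support_rotate_iff u hu).1 (d.getVert_mem_support i)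
  obtain ⟨n, hn⟩ : ∃ n, d.length = n + 6 := ⟨d.length - 6, by omega⟩
  have hinj : ∀ i j, i < n + 6 → j < n + 6 → d.getVert i = d.getVert j → i = j :=
    fun i j hi hj e => hd.getVert_injOn' (by rw [Set.mem_ofPred]; omega)
      (by rw [Set.mem_ofPred]; omega) e
  have hd0 : d.getVert 0 = u := d.getVert_zero
  have hdn : d.getVert (n + 6) = u := hn ▸ d.getVert_length
  have hadj : ∀ i < n + 6, G.Adj (d.getVert i) (d.getVert (i + 1)) := fun i hi =>
    d.adj_getVert_succ (by omega)
  have hnadj : ∀ i j, i < j → j < n + 6 → j ≠ i + 1 → ¬ (i = 0 ∧ j = n + 5) →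
      ¬ G.Adj (d.getVert i) (d.getVert j) := by
    intro i j hi hj h1 h2 ha
    refine hch s(d.getVert i, d.getVert j)
      (Walk.isChord_sym2Mk.2 ⟨ha, fun hm => ?_, hmem i, hmem j⟩)
    rw [← (c.rotate_edges u hu).mem_iff, Walk.mk_mem_edges_iff_exists] at hm
    obtain ⟨k, hk, e⟩ := hm
    change k < d.length at hk
    change s(d.getVert k, d.getVert (k + 1)) = _ at e
    -- Index `n + 6` is again `u`, outside the range of injectivity, so the closing edge needs its
    -- own case.
    have hlast : ∀ l < n + 6, d.getVert (k + 1) = d.getVert l → l = k + 1 ∨ l = 0 ∧ k = n + 5 := by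
      intro l hl e
      rcases Nat.lt_or_ge (k + 1) (n + 6) with hk' | hk'
      · exact Or.inl (hinj _ _ hk' hl e).symm
      · obtain rfl : k = n + 5 := by omega
        exact Or.inr ⟨(hinj 0 l (by omega) hl (by rw [hd0, ← e]; exact hdn.symm)).symm, rfl⟩
    rcases Sym2.eq_iff.1 e with ⟨e1, e2⟩ | ⟨e1, e2⟩
    · have := hinj _ _ (by omega) (by omega) e1
      have := hlast _ (by omega) e2
      omega
    · have := hinj _ _ (by omega) (by omega) e1
      have := hlast _ (by omega) e2
      omega
  refine ⟨d.getVert (n + 4), hmem _, d.getVert (n + 5), hmem _, d.getVert 1, hmem _,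
    d.getVert 2, hmem _, fun e => ?_, ?_, ?_, ?_, hadj 1 (by omega), ?_, ?_⟩
  · have := hinj _ _ (by omega) (by omega) e
    omega
  · have := hadj (n + 5) (by omega)
    rw [hdn] at this
    exact this.symm
  · have := hadj 0 (by omega)
    rwa [hd0] at this
  · exact (hadj (n + 4) (by omega)).symm
  · exact hnadj _ _ (by omega) (by omega) (by omega) (by omega)
  · rw [G.adj_comm]
    exact hnadj _ _ (by omega) (by omega) (by omega) (by omega)

end TwoChordal

/-! ### Simple vertices of the split graph, and the reduction from two chords to one. -/

namespace TwoChordal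

open SimpleGraph

namespace FinGraph

variable {V : Type*} [DecidableEq V] {H : FinGraph V}

theorem mem_nbhd {u v : V} : u ∈ H.nbhd v ↔ u ∈ H.verts ∧ s(v, u) ∈ H.edges :=
  Finset.mem_filter

theorem mem_closedNbhd {u v : V} :
    u ∈ H.closedNbhd v ↔ u = v ∨ u ∈ H.verts ∧ s(v, u) ∈ H.edges := by
  rw [closedNbhd, Finset.mem_insert, mem_nbhd]

theorem isSimple_iff {v : V} : H.IsSimple v ↔ ∀ a ∈ H.nbhd v, ∀ b ∈ H.nbhd v,
    H.closedNbhd a ⊆ H.closedNbhd b ∨ H.closedNbhd b ⊆ H.closedNbhd a := by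
  constructor
  · rintro ⟨l, -, hl, hp⟩ a ha b hb
    rw [← hl, List.mem_toFinset] at ha hb
    let R (a b : V) : Prop := H.closedNbhd a ⊆ H.closedNbhd b ∨ H.closedNbhd b ⊆ H.closedNbhd a
    have : Std.Symm R := ⟨fun _ _ h => h.symm⟩
    have hR : l.Pairwise R := hp.imp Or.inl
    exact List.Pairwise.forall_of_forall (R := R) (fun _ _ => Or.inl (Finset.Subset.refl _)) hR ha hb
  · intro h
    -- For pairwise comparable sets, sorting by cardinality sorts by inclusion.
    let r (a b : V) : Prop := (H.closedNbhd a).card ≤ (H.closedNbhd b).card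
    have : Std.Total r := ⟨fun a b => le_total _ _⟩
    have : IsTrans V r := ⟨fun a b c => le_trans⟩
    let l := (H.nbhd v).toList.insertionSort r
    have hperm : l.Perm (H.nbhd v).toList := List.perm_insertionSort _ _
    refine ⟨l, hperm.nodup_iff.2 (Finset.nodup_toList _), ?_, ?_⟩
    · rw [List.toFinset_eq_of_perm _ _ hperm, Finset.toList_toFinset]
    · have hmem : ∀ a ∈ l, a ∈ H.nbhd v := fun a ha => Finset.mem_toList.1 (hperm.mem_iff.1 ha)
      refine (List.pairwise_insertionSort r _).imp_of_mem fun {a b} ha hb hab => ?_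
      rcases h a (hmem a ha) b (hmem b hb) with h | h
      · exact h
      · exact (Finset.eq_of_subset_of_card_le h hab).symm.subset

end FinGraph

namespace BiGraph

variable {V : Type*} {G : BiGraph V}

theorem notMem_X_of_mem_Y {u : V} (h : u ∈ G.Y) : u ∉ G.X :=
  fun h' => Finset.disjoint_left.1 G.disj h' h

theorem mem_XY_of_mem_E {u v : V} (h : s(u, v) ∈ G.E) :
    (u ∈ G.X ∧ v ∈ G.Y) ∨ (u ∈ G.Y ∧ v ∈ G.X) := by
  obtain ⟨x, hx, y, hy, e⟩ := G.bip _ h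
  rcases Sym2.eq_iff.1 e with ⟨rfl, rfl⟩ | ⟨rfl, rfl⟩
  · exact Or.inl ⟨hx, hy⟩
  · exact Or.inr ⟨hy, hx⟩

theorem adj_iff {u v : V} : G.toSimpleGraph.Adj u v ↔ s(u, v) ∈ G.E := by
  rw [toSimpleGraph, fromEdgeSet_adj, Finset.mem_coe, and_iff_left_iff_imp]
  rintro h rfl
  rcases mem_XY_of_mem_E h with h | h
  · exact notMem_X_of_mem_Y h.2 h.1
  · exact notMem_X_of_mem_Y h.1 h.2

theorem mem_edgeSet {e : Sym2 V} : e ∈ G.toSimpleGraph.edgeSet ↔ e ∈ G.E := by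
  induction e with | _ u v
  exact adj_iff

variable [DecidableEq V]

/-- A cycle of `G - e` has two chords in `G`, and at most one of them is `e`. Conversely, deleting a
chord `e` of a cycle leaves the cycle intact, and its chord in `G - e` differs from `e`. -/
theorem isTwoChordal_iff : G.IsTwoChordal ↔ CyclesHaveChord G.toSimpleGraph ∧
    ∀ e ∈ G.E, CyclesHaveChord (G.deleteEdge e).toSimpleGraph := by
  constructor
  · refine fun h => ⟨fun v c hc hl => ?_, fun e he v c hc hl => ?_⟩
    · obtain ⟨e, -, -, he, -⟩ := h v c hc hl
      exact ⟨e, he⟩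
    · have hle : (G.deleteEdge e).toSimpleGraph ≤ G.toSimpleGraph := fun u v huv =>
        adj_iff.2 (Finset.mem_of_mem_erase (adj_iff.1 huv))
      obtain ⟨e₁, e₂, hne, h₁, h₂⟩ := h v (c.mapLe hle) (hc.mapLe hle) (by simpa using hl)
      have key : ∀ f, f ≠ e → (c.mapLe hle).IsChord f → c.IsChord f := by
        intro f hf hch
        induction f with | _ u w
        rw [Walk.isChord_sym2Mk] at hch ⊢
        rw [Walk.edges_mapLe_eq_edges, Walk.support_mapLe_eq_support] at hch
        exact ⟨adj_iff.2 (Finset.mem_erase.2 ⟨hf, adj_iff.1 hch.1⟩), hch.2⟩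
      by_cases h : e₁ = e
      · exact ⟨e₂, key e₂ (fun h' => hne (h.trans h'.symm)) h₂⟩
      · exact ⟨e₁, key e₁ h h₁⟩
  · rintro ⟨h, hE⟩ v c hc hl
    obtain ⟨e, he⟩ := h v c hc hl
    have hsub : ∀ f ∈ c.edges, f ∈ (G.deleteEdge e).toSimpleGraph.edgeSet := fun f hf =>
      mem_edgeSet.2 (Finset.mem_erase.2 ⟨fun h => he.2.1 (h ▸ hf),
        mem_edgeSet.1 (c.edges_subset_edgeSet hf)⟩)
    obtain ⟨f, hf⟩ := hE e (mem_edgeSet.1 he.1) v (c.transfer _ hsub) (hc.transfer hsub)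
      (by simpa using hl)
    refine ⟨e, f, ?_, he, ?_⟩
    · rintro rfl
      exact (Finset.mem_erase.1 (mem_edgeSet.1 hf.1)).1 rfl
    · induction f with | _ u w
      rw [Walk.isChord_sym2Mk] at hf ⊢
      rw [Walk.edges_transfer, Walk.support_transfer] at hf
      exact ⟨adj_iff.2 (Finset.mem_of_mem_erase (adj_iff.1 hf.1)), hf.2⟩

/-- `H` is an induced subgraph of the split graph obtained from `G` by making `X` a clique. -/
structure IsInducedSplit (G : BiGraph V) (H : FinGraph V) : Prop where
  sub : H.verts ⊆ G.X ∪ G.Y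
  iff : ∀ u ∈ H.verts, ∀ v ∈ H.verts,
    (s(u, v) ∈ H.edges ↔ s(u, v) ∈ G.E ∨ u ∈ G.X ∧ v ∈ G.X ∧ u ≠ v)

namespace IsInducedSplit

variable {H : FinGraph V}

theorem delete (h : G.IsInducedSplit H) (v : V) : G.IsInducedSplit (H.delete v) := by
  refine ⟨(Finset.erase_subset _ _).trans h.sub, fun u hu w hw => ?_⟩
  obtain ⟨huv, hu⟩ := Finset.mem_erase.1 hu
  obtain ⟨hwv, hw⟩ := Finset.mem_erase.1 hw
  rw [← h.iff u hu w hw, FinGraph.delete, Finset.mem_filter, and_iff_left_iff_imp]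
  intro _ hv
  rcases Sym2.mem_iff.1 hv with rfl | rfl
  · exact huv rfl
  · exact hwv rfl

theorem mem_Y (h : G.IsInducedSplit H) {u : V} (hu : u ∈ H.verts) (hX : u ∉ G.X) : u ∈ G.Y :=
  (Finset.mem_union.1 (h.sub hu)).resolve_left hX

/-- All neighbors of a vertex of `Y` lie in the clique `X`, so their closed neighborhoods differ
only inside `Y`, where `exists_nest_row` supplies the nesting. Without vertices of `Y`, `H` is a
clique. -/
theorem exists_isSimple (h : G.IsInducedSplit H) (hG : CyclesHaveChord G.toSimpleGraph)
    (hH : H.verts ≠ ∅) : ∃ v ∈ H.verts, H.IsSimple v := by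
  by_cases hY : ∃ y ∈ H.verts, y ∈ G.Y
  · let R : Set V := {v | v ∈ H.verts ∧ v ∈ G.Y}
    let C : Set V := {v | v ∈ H.verts ∧ v ∈ G.X}
    have : Finite R := H.verts.finite_toSet.subset fun v hv => hv.1
    have : Finite C := H.verts.finite_toSet.subset fun v hv => hv.1
    obtain ⟨y, hy, hyY⟩ := hY
    have : Nonempty R := ⟨⟨y, hy, hyY⟩⟩
    obtain ⟨⟨r, hr, hrY⟩, hnest⟩ := exists_nest_row
      (fun (u : R) (v : C) => G.toSimpleGraph.Adj u v) fun N r c hN hc => by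
        refine hG.not_chordlessCycle ?_ ?_ ?_ hN hc
        · exact Set.disjoint_left.2 fun v hv hv' => notMem_X_of_mem_Y hv.2 hv'.2
        · intro u hu v hv huv
          rcases mem_XY_of_mem_E (adj_iff.1 huv) with h | h
          · exact notMem_X_of_mem_Y hu.2 h.1
          · exact notMem_X_of_mem_Y hv.2 h.2
        · intro u hu v hv huv
          rcases mem_XY_of_mem_E (adj_iff.1 huv) with h | h
          · exact notMem_X_of_mem_Y h.2 hv.2
          · exact notMem_X_of_mem_Y h.1 hu.2
    have hnb : ∀ a ∈ H.nbhd r, a ∈ H.verts ∧ a ∈ G.X ∧ s(r, a) ∈ G.E := by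
      intro a ha
      obtain ⟨ha, hra⟩ := FinGraph.mem_nbhd.1 ha
      rcases (h.iff r hr a ha).1 hra with hra | hra
      · rcases mem_XY_of_mem_E hra with h | h
        · exact absurd h.1 (notMem_X_of_mem_Y hrY)
        · exact ⟨ha, h.2, hra⟩
      · exact absurd hra.1 (notMem_X_of_mem_Y hrY)
    have hsub : ∀ a ∈ H.nbhd r, ∀ b ∈ H.nbhd r,
        (∀ w ∈ H.verts, w ∈ G.Y → s(w, a) ∈ G.E → s(w, b) ∈ G.E) →
        H.closedNbhd a ⊆ H.closedNbhd b := by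
      intro a ha b hb hab w hw
      obtain ⟨ha, haX, -⟩ := hnb a ha
      obtain ⟨hb, hbX, -⟩ := hnb b hb
      rw [FinGraph.mem_closedNbhd] at hw ⊢
      have hwv : w ∈ H.verts := by
        rcases hw with rfl | hw
        · exact ha
        · exact hw.1
      by_cases hwb : w = b
      · exact Or.inl hwb
      refine Or.inr ⟨hwv, (h.iff b hb w hwv).2 ?_⟩
      by_cases hwX : w ∈ G.X
      · exact Or.inr ⟨hbX, hwX, Ne.symm hwb⟩
      · rcases hw with rfl | ⟨-, hw⟩
        · exact absurd haX hwX
        · rcases (h.iff a ha w hwv).1 hw with hw | hw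
          · rw [Sym2.eq_swap] at hw ⊢
            exact Or.inl (hab w hwv (h.mem_Y hwv hwX) hw)
          · exact absurd hw.2.1 hwX
    refine ⟨r, hr, FinGraph.isSimple_iff.2 fun a ha b hb => ?_⟩
    obtain ⟨hav, haX, hra⟩ := hnb a ha
    obtain ⟨hbv, hbX, hrb⟩ := hnb b hb
    rcases hnest ⟨a, hav, haX⟩ ⟨b, hbv, hbX⟩ (adj_iff.2 hra) (adj_iff.2 hrb) with h | h
    · exact Or.inl (hsub a ha b hb fun w hw hwY hwa =>
        adj_iff.1 (h ⟨w, hw, hwY⟩ (adj_iff.2 hwa)))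
    · exact Or.inr (hsub b hb a ha fun w hw hwY hwa =>
        adj_iff.1 (h ⟨w, hw, hwY⟩ (adj_iff.2 hwa)))
  · push Not at hY
    have hX : ∀ v ∈ H.verts, v ∈ G.X := fun v hv => by
      by_contra hvX
      exact hY v hv (h.mem_Y hv hvX)
    obtain ⟨v, hv⟩ := Finset.nonempty_iff_ne_empty.2 hH
    refine ⟨v, hv, FinGraph.isSimple_iff.2 fun a ha b hb => Or.inl fun w hw => ?_⟩
    have ha := (FinGraph.mem_nbhd.1 ha).1
    have hb := (FinGraph.mem_nbhd.1 hb).1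
    rw [FinGraph.mem_closedNbhd] at hw ⊢
    have hwv : w ∈ H.verts := by
      rcases hw with rfl | hw
      · exact ha
      · exact hw.1
    by_cases hwb : w = b
    · exact Or.inl hwb
    · exact Or.inr ⟨hwv, (h.iff b hb w hwv).2 (Or.inr ⟨hX b hb, hX w hwv, Ne.symm hwb⟩)⟩

/-- If `u` is in `X`, its two neighbors on the cycle are distinct, nonadjacent vertices of `Y`, so
neither lies in the other's closed neighborhood. If `u` is in `Y`, the next vertices `y₁` and `y₂`
along the cycle witness that the closed neighborhoods of `x₁` and `x₂` are incomparable. -/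
theorem not_isSimple_of_mem_chordless (h : G.IsInducedSplit H) {v : V}
    {c : G.toSimpleGraph.Walk v v} (hc : c.IsCycle) (hlen : 6 ≤ c.length)
    (hch : ∀ e, ¬ c.IsChord e) (hsub : ∀ u ∈ c.support, u ∈ H.verts) {u : V}
    (hu : u ∈ c.support) : ¬ H.IsSimple u := by
  obtain ⟨y₁, hy₁, x₁, hx₁, x₂, hx₂, y₂, hy₂, hne, hux₁, hux₂, hxy₁, hxy₂, hn₁, hn₂⟩ :=
    exists_induced_path_of_chordless hc hlen hch hu
  rw [adj_iff] at hux₁ hux₂ hxy₁ hxy₂ hn₁ hn₂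
  intro hs
  have hmem : ∀ x ∈ c.support, s(u, x) ∈ G.E → x ∈ H.nbhd u := fun x hx hux =>
    FinGraph.mem_nbhd.2 ⟨hsub x hx, (h.iff u (hsub u hu) x (hsub x hx)).2 (Or.inl hux)⟩
  by_cases huX : u ∈ G.X
  · have hY : ∀ x, s(u, x) ∈ G.E → x ∈ G.Y := fun x hx =>
      (mem_XY_of_mem_E hx).elim (fun h => h.2) (fun h => absurd huX (notMem_X_of_mem_Y h.1))
    have key : ∀ x ∈ c.support, ∀ x' ∈ c.support, x ∈ G.Y → x' ∈ G.Y →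
        H.closedNbhd x ⊆ H.closedNbhd x' → x = x' := by
      intro x hx x' hx' hxY hxY' hss
      rcases FinGraph.mem_closedNbhd.1 (hss (FinGraph.mem_closedNbhd.2 (Or.inl rfl))) with e | e
      · exact e
      · rcases (h.iff x' (hsub x' hx') x (hsub x hx)).1 e.2 with e | e
        · rcases mem_XY_of_mem_E e with e | e
          · exact absurd e.1 (notMem_X_of_mem_Y hxY')
          · exact absurd e.2 (notMem_X_of_mem_Y hxY)
        · exact absurd e.1 (notMem_X_of_mem_Y hxY')
    rcases FinGraph.isSimple_iff.1 hs x₁ (hmem _ hx₁ hux₁) x₂ (hmem _ hx₂ hux₂) with hss | hss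
    · exact hne (key _ hx₁ _ hx₂ (hY _ hux₁) (hY _ hux₂) hss)
    · exact hne (key _ hx₂ _ hx₁ (hY _ hux₂) (hY _ hux₁) hss).symm
  · have hX : ∀ x, s(u, x) ∈ G.E → x ∈ G.X := fun x hx =>
      (mem_XY_of_mem_E hx).elim (fun h => absurd h.1 huX) (fun h => h.2)
    have key : ∀ x ∈ c.support, ∀ x' ∈ c.support, ∀ y ∈ c.support, x ∈ G.X → x' ∈ G.X →
        s(x, y) ∈ G.E → H.closedNbhd x ⊆ H.closedNbhd x' → s(x', y) ∈ G.E := by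
      intro x hx x' hx' y hy hxX hxX' hxy hss
      have hyY : y ∈ G.Y := (mem_XY_of_mem_E hxy).elim (fun h => h.2)
        (fun h => absurd hxX (notMem_X_of_mem_Y h.1))
      have hyx : y ∈ H.closedNbhd x := FinGraph.mem_closedNbhd.2
        (Or.inr ⟨hsub y hy, (h.iff x (hsub x hx) y (hsub y hy)).2 (Or.inl hxy)⟩)
      rcases FinGraph.mem_closedNbhd.1 (hss hyx) with rfl | e
      · exact absurd hxX' (notMem_X_of_mem_Y hyY)
      · rcases (h.iff x' (hsub x' hx') y (hsub y hy)).1 e.2 with e | e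
        · exact e
        · exact absurd e.2.1 (notMem_X_of_mem_Y hyY)
    rcases FinGraph.isSimple_iff.1 hs x₁ (hmem _ hx₁ hux₁) x₂ (hmem _ hx₂ hux₂) with hss | hss
    · exact hn₁ (key _ hx₁ _ hx₂ _ hy₁ (hX _ hux₁) (hX _ hux₂) hxy₁ hss)
    · exact hn₂ (key _ hx₂ _ hx₁ _ hy₂ (hX _ hux₂) (hX _ hux₁) hxy₂ hss)

end IsInducedSplit

end BiGraph

end TwoChordal

/-! ### Runs of the algorithm. -/

namespace TwoChordal

variable {V : Type*} [DecidableEq V] {G : BiGraph V}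

/-- Every run from the configuration `s` ends, by returning `b`. -/
inductive RunsTo (G : BiGraph V) : State V → Bool → Prop
  | done (b : Bool) : RunsTo G (.done b) b
  | step {s : State V} {b : Bool} (hex : ∃ t, Step G s t) (hall : ∀ t, Step G s t → RunsTo G t b) :
      RunsTo G s b

namespace RunsTo

theorem not_infinite {s : State V} {b : Bool} (h : RunsTo G s b) :
    ¬ ∃ r : ℕ → State V, r 0 = s ∧ ∀ n, Step G (r n) (r (n + 1)) := by
  induction h with
  | done b =>
    rintro ⟨r, h0, hr⟩
    have := hr 0
    rw [h0] at this
    cases this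
  | step _ _ ih =>
    rintro ⟨r, rfl, hr⟩
    exact ih (r 1) (hr 0) ⟨fun n => r (n + 1), rfl, fun n => hr (n + 1)⟩

theorem of_reflTransGen {s t : State V} {b : Bool} (h : RunsTo G s b)
    (hst : Relation.ReflTransGen (Step G) s t) : RunsTo G t b := by
  induction hst with
  | refl => exact h
  | tail _ hstep ih =>
    cases ih with
    | done => cases hstep
    | step _ hall => exact hall _ hstep

theorem exists_reflTransGen {s : State V} {b : Bool} (h : RunsTo G s b) :
    Relation.ReflTransGen (Step G) s (.done b) := by
  induction h with
  | done => exact .refl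
  | step hex _ ih =>
    obtain ⟨t, ht⟩ := hex
    exact .head ht (ih t ht)

theorem halts {b : Bool} (h : RunsTo G .start b) : Halts G := by
  refine ⟨h.not_infinite, fun s hs hstuck => ?_⟩
  cases h.of_reflTransGen hs with
  | done => exact ⟨_, rfl⟩
  | step hex _ => exact absurd hex.choose_spec (hstuck _)

theorem returns_iff {b b' : Bool} (h : RunsTo G .start b) : Returns G b' ↔ b' = b := by
  constructor
  · intro hb
    cases h.of_reflTransGen hb with
    | done => rfl
    | step hex _ => nomatch hex.choose_spec
  · rintro rfl
    exact h.exists_reflTransGen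

theorem glueInner {p : Pass V} {yet todo : Finset V} {x : V} {b : Bool} (inner : Finset V)
    (H : FinGraph V) (hx : x ∈ H.verts) (hsub : inner ⊆ H.verts) (hxi : x ∉ inner)
    (h : ∀ H' : FinGraph V, H'.verts = H.verts →
      (∀ e, e ∈ H'.edges ↔ e ∈ H.edges ∨ ∃ v ∈ inner, e = s(x, v)) →
      RunsTo G (.glueOuter p H' yet todo) b) :
    RunsTo G (.glueInner p H yet todo x inner) b := by
  induction inner using Finset.strongInduction generalizing H with
  | H inner ih =>
    refine .step ?_ fun t ht => ?_
    · rcases inner.eq_empty_or_nonempty with rfl | ⟨v, hv⟩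
      · exact ⟨_, .glueAddEnd⟩
      · exact ⟨_, .glueAdd hv⟩
    · cases ht with
      | @glueAdd _ _ _ _ _ _ v hv =>
        have hvx : x ≠ v := fun e => hxi (e ▸ hv)
        refine ih _ (Finset.erase_ssubset hv) (H.addEdge x v) hx
          ((Finset.erase_subset _ _).trans hsub) (fun h' => hxi (Finset.mem_of_mem_erase h'))
          fun H' hV hE => h H' hV fun e => ?_
        have hadd : (H.addEdge x v).edges = insert s(x, v) H.edges :=
          if_pos ⟨hx, hsub hv, hvx⟩
        rw [hE, hadd, Finset.mem_insert]
        constructor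
        · rintro ((rfl | he) | ⟨w, hw, rfl⟩)
          · exact Or.inr ⟨v, hv, rfl⟩
          · exact Or.inl he
          · exact Or.inr ⟨w, Finset.mem_of_mem_erase hw, rfl⟩
        · rintro (he | ⟨w, hw, rfl⟩)
          · exact Or.inl (Or.inr he)
          · by_cases hwv : w = v
            · exact Or.inl (Or.inl (hwv ▸ rfl))
            · exact Or.inr ⟨w, Finset.mem_erase.2 ⟨hwv, hw⟩, rfl⟩
      | glueAddEnd => exact h H rfl (by simp)

/-- `yetToGlue` and the vertices still to visit start equal and lose the same element, so one set
`T` serves for both. Each pair is glued when the first of its two vertices is visited. -/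
theorem glueOuter {p : Pass V} {b : Bool} (T : Finset V) (H : FinGraph V) (hsub : T ⊆ H.verts)
    (h : ∀ H' : FinGraph V, H'.verts = H.verts →
      (∀ e, e ∈ H'.edges ↔ e ∈ H.edges ∨ ∃ u ∈ T, ∃ v ∈ T, u ≠ v ∧ e = s(u, v)) →
      RunsTo G (.whileHead p H' 0) b) :
    RunsTo G (.glueOuter p H T T) b := by
  induction T using Finset.strongInduction generalizing H with
  | H T ih =>
    refine .step ?_ fun t ht => ?_
    · rcases T.eq_empty_or_nonempty with rfl | ⟨x, hx⟩
      · exact ⟨_, .glueEnd⟩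
      · exact ⟨_, .glueNext hx⟩
    · cases ht with
      | @glueNext _ _ _ _ x hx =>
        have hT := (Finset.erase_subset x T).trans hsub
        refine glueInner _ H (hsub hx) hT (Finset.notMem_erase _ _) fun H₁ hV₁ hE₁ => ?_
        refine ih _ (Finset.erase_ssubset hx) H₁ (hV₁ ▸ hT) fun H' hV hE =>
          h H' (hV.trans hV₁) fun e => ?_
        rw [hE, hE₁]
        constructor
        · rintro ((he | ⟨v, hv, rfl⟩) | ⟨u, hu, v, hv, huv, rfl⟩)
          · exact Or.inl he
          · exact Or.inr ⟨x, hx, v, Finset.mem_of_mem_erase hv,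
              (Finset.ne_of_mem_erase hv).symm, rfl⟩
          · exact Or.inr ⟨u, Finset.mem_of_mem_erase hu, v, Finset.mem_of_mem_erase hv, huv, rfl⟩
        · rintro (he | ⟨u, hu, v, hv, huv, rfl⟩)
          · exact Or.inl (Or.inl he)
          · by_cases hux : u = x
            · subst hux
              exact Or.inl (Or.inr ⟨v, Finset.mem_erase.2 ⟨huv.symm, hv⟩, rfl⟩)
            · by_cases hvx : v = x
              · subst hvx
                exact Or.inl (Or.inr ⟨u, Finset.mem_erase.2 ⟨hux, hu⟩, Sym2.eq_swap⟩)
              · exact Or.inr ⟨u, Finset.mem_erase.2 ⟨hux, hu⟩, v, Finset.mem_erase.2 ⟨hvx, hv⟩,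
                  huv, rfl⟩
      | glueEnd => exact h H rfl (by simp)

theorem exists_step_scan (p : Pass V) (H : FinGraph V) (flag : ℕ) (todo : Finset V) :
    ∃ t, Step G (.scan p H flag todo) t := by
  rcases todo.eq_empty_or_nonempty with rfl | ⟨v, hv⟩
  · exact ⟨_, .scanEnd⟩
  · by_cases hs : H.IsSimple v
    · exact ⟨_, .scanSimple hv hs⟩
    · exact ⟨_, .scanNext hv hs⟩

/-- If the graphs with `P` have a simple vertex and `P` survives the deletion of vertices, then the
elimination succeeds. -/
theorem whileHead_of_exists_isSimple {p : Pass V} {b : Bool} (P : FinGraph V → Prop)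
    (hex : ∀ H, P H → H.verts ≠ ∅ → ∃ v ∈ H.verts, H.IsSimple v)
    (hdel : ∀ H v, P H → P (H.delete v))
    (htest : ∀ flag, flag ≠ 2 → RunsTo G (.test p flag) b) (H : FinGraph V) (hP : P H) :
    RunsTo G (.whileHead p H 0) b := by
  have hexit : ∀ (H : FinGraph V) flag, flag ≠ 2 → ¬ (H.verts ≠ ∅ ∧ flag = 0) →
      RunsTo G (.whileHead p H flag) b := by
    intro H flag hflag hc
    refine .step ⟨_, .whileExit hc⟩ fun t ht => ?_
    cases ht with
    | whileEnter h1 h2 => exact absurd ⟨h1, h2⟩ hc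
    | whileExit _ => exact htest _ hflag
  induction hn : H.verts.card using Nat.strong_induction_on generalizing H with
  | _ n ih =>
    subst hn
    by_cases hne : H.verts = ∅
    · exact hexit _ _ (by norm_num) fun h => h.1 hne
    -- Skipping nonsimple vertices keeps a simple one among those still to visit, so the scan cannot
    -- run out.
    have hscan : ∀ todo ⊆ H.verts, (∃ v ∈ todo, H.IsSimple v) →
        RunsTo G (.scan p H 0 todo) b := by
      intro todo
      induction todo using Finset.strongInduction with
      | H todo ihs =>
        intro hsub hsimple
        refine .step (exists_step_scan _ _ _ _) fun t ht => ?_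
        cases ht with
        | @scanSimple _ _ _ _ v hv hs =>
          split_ifs with hemp
          · exact hexit _ _ (by norm_num) fun h => h.1 hemp
          · exact ih _ (Finset.card_erase_lt_of_mem (hsub hv)) _ (hdel _ _ hP) rfl
        | @scanNext _ _ _ _ v hv hs =>
          obtain ⟨w, hw, hws⟩ := hsimple
          exact ihs _ (Finset.erase_ssubset hv) ((Finset.erase_subset _ _).trans hsub)
            ⟨w, Finset.mem_erase.2 ⟨fun e => hs (e ▸ hws), hw⟩, hws⟩
        | scanEnd =>
          obtain ⟨w, hw, -⟩ := hsimple
          exact absurd hw (Finset.notMem_empty _)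
    refine .step ⟨_, .whileEnter hne rfl⟩ fun t ht => ?_
    cases ht with
    | whileEnter _ _ => exact hscan _ subset_rfl (hex _ hP hne)
    | whileExit h => exact absurd ⟨hne, rfl⟩ h

/-- If the graphs with `P` are nonempty and `P` survives the deletion of simple vertices, then the
elimination fails. -/
theorem whileHead_of_nonempty {p : Pass V} (P : FinGraph V → Prop) (hne : ∀ H, P H → H.verts ≠ ∅)
    (hdel : ∀ H v, P H → H.IsSimple v → P (H.delete v)) (H : FinGraph V) (hP : P H) :
    RunsTo G (.whileHead p H 0) false := by
  have hfail : ∀ H : FinGraph V, RunsTo G (.whileHead p H 2) false := by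
    intro H
    refine .step ⟨_, .whileExit (by simp)⟩ fun t ht => ?_
    cases ht with
    | whileEnter _ h => exact absurd h (by norm_num)
    | whileExit _ =>
      refine .step ⟨_, .testFail rfl⟩ fun t ht => ?_
      cases ht with
      | testFail => exact .done _
      | testMain h => exact absurd rfl h
      | testEdge h => exact absurd rfl h
  induction hn : H.verts.card using Nat.strong_induction_on generalizing H with
  | _ n ih =>
    subst hn
    have hscan : ∀ todo ⊆ H.verts, RunsTo G (.scan p H 0 todo) false := by
      intro todo
      induction todo using Finset.strongInduction with
      | H todo ihs =>
        intro hsub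
        refine .step (exists_step_scan _ _ _ _) fun t ht => ?_
        cases ht with
        | @scanSimple _ _ _ _ v hv hs =>
          rw [if_neg (hne _ (hdel _ _ hP hs))]
          exact ih _ (Finset.card_erase_lt_of_mem (hsub hv)) _ (hdel _ _ hP hs) rfl
        | @scanNext _ _ _ _ v hv hs =>
          exact ihs _ (Finset.erase_ssubset hv) ((Finset.erase_subset _ _).trans hsub)
        | scanEnd => exact hfail H
    refine .step ⟨_, .whileEnter (hne _ hP) rfl⟩ fun t ht => ?_
    cases ht with
    | whileEnter _ _ => exact hscan _ subset_rfl
    | whileExit h => exact absurd ⟨hne _ hP, rfl⟩ h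

theorem glueOuter_forget {p : Pass V} {b : Bool} (G' : BiGraph V)
    (h : ∀ H : FinGraph V, H.verts = G'.X ∪ G'.Y → G'.IsInducedSplit H →
      RunsTo G (.whileHead p H 0) b) :
    RunsTo G (.glueOuter p G'.forget G'.X G'.X) b := by
  refine glueOuter _ _ Finset.subset_union_left fun H hV hE =>
    h H hV ⟨hV.le, fun u _ v _ => ?_⟩
  rw [hE]
  refine or_congr Iff.rfl ⟨?_, fun ⟨hu, hv, huv⟩ => ⟨u, hu, v, hv, huv, rfl⟩⟩
  rintro ⟨x, hx, y, hy, hxy, e⟩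
  rcases Sym2.eq_iff.1 e with ⟨rfl, rfl⟩ | ⟨rfl, rfl⟩
  · exact ⟨hx, hy, hxy⟩
  · exact ⟨hy, hx, hxy.symm⟩

theorem check_of_cyclesHaveChord {p : Pass V} {b : Bool} {G' : BiGraph V}
    (hG' : CyclesHaveChord G'.toSimpleGraph)
    (htest : ∀ flag, flag ≠ 2 → RunsTo G (.test p flag) b) :
    RunsTo G (.glueOuter p G'.forget G'.X G'.X) b :=
  glueOuter_forget G' fun H _ hH => whileHead_of_exists_isSimple G'.IsInducedSplit
    (fun _ h => h.exists_isSimple hG') (fun _ v h => h.delete v) htest H hH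

theorem check_of_not_cyclesHaveChord {p : Pass V} {G' : BiGraph V}
    (hG' : ¬ CyclesHaveChord G'.toSimpleGraph) :
    RunsTo G (.glueOuter p G'.forget G'.X G'.X) false := by
  simp only [CyclesHaveChord, not_forall, not_exists] at hG'
  obtain ⟨v, c, hc, hlen, hch⟩ := hG'
  -- The invariant is that the chordless cycle survives: only simple vertices are deleted, and none
  -- of its vertices is simple.
  refine glueOuter_forget G' fun H hV hH => whileHead_of_nonempty
    (fun H => G'.IsInducedSplit H ∧ ∀ u ∈ c.support, u ∈ H.verts) (fun H h => ?_)
    (fun H w h hw => ⟨h.1.delete w, fun u hu => Finset.mem_erase.2 ⟨?_, h.2 u hu⟩⟩) H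
    ⟨hH, fun u hu => ?_⟩
  · exact Finset.ne_empty_of_mem (h.2 v c.start_mem_support)
  · rintro rfl
    exact h.1.not_isSimple_of_mem_chordless hc hlen hch h.2 hu hw
  · obtain ⟨-, -, x, hx, -, -, -, -, -, hux, -⟩ :=
      exists_induced_path_of_chordless hc hlen hch hu
    rw [hV, Finset.mem_union]
    exact (BiGraph.mem_XY_of_mem_E (BiGraph.adj_iff.1 hux)).imp And.left And.left

theorem exists_step_edgeHead (todo : Finset (Sym2 V)) : ∃ t, Step G (.edgeHead todo) t := by
  rcases todo.eq_empty_or_nonempty with rfl | ⟨e, he⟩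
  · exact ⟨_, .edgeEnd⟩
  · exact ⟨_, .edgeNext he⟩

theorem test_edge {rest : Finset (Sym2 V)} {b : Bool} (h : RunsTo G (.edgeHead rest) b) (flag : ℕ)
    (hflag : flag ≠ 2) : RunsTo G (.test (.edge rest) flag) b := by
  refine .step ⟨_, .testEdge hflag⟩ fun t ht => ?_
  cases ht with
  | testFail h => exact absurd h hflag
  | testEdge _ => exact h

theorem test_main {b : Bool} (h : RunsTo G (.edgeHead G.E) b) (flag : ℕ)
    (hflag : flag ≠ 2) : RunsTo G (.test .main flag) b := by
  refine .step ⟨_, .testMain hflag⟩ fun t ht => ?_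
  cases ht with
  | testFail h => exact absurd h hflag
  | testMain _ => exact h

theorem edgeHead_of_forall (todo : Finset (Sym2 V))
    (h : ∀ e ∈ todo, CyclesHaveChord (G.deleteEdge e).toSimpleGraph) :
    RunsTo G (.edgeHead todo) true := by
  induction todo using Finset.strongInduction with
  | H todo ih =>
    refine .step (exists_step_edgeHead _) fun t ht => ?_
    cases ht with
    | @edgeNext _ e he =>
      exact check_of_cyclesHaveChord (G' := G.deleteEdge e) (h e he) (test_edge
        (ih _ (Finset.erase_ssubset he) fun f hf => h f (Finset.mem_of_mem_erase hf)))
    | edgeEnd => exact .done _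

theorem edgeHead_of_exists (todo : Finset (Sym2 V))
    (h : ∃ e ∈ todo, ¬ CyclesHaveChord (G.deleteEdge e).toSimpleGraph) :
    RunsTo G (.edgeHead todo) false := by
  induction todo using Finset.strongInduction with
  | H todo ih =>
    refine .step (exists_step_edgeHead _) fun t ht => ?_
    cases ht with
    | @edgeNext _ e he =>
      by_cases hc : CyclesHaveChord (G.deleteEdge e).toSimpleGraph
      -- The edge just visited passes its check, so the failing edge is a different one and is still
      -- to be visited.
      · obtain ⟨f, hf, hfc⟩ := h
        exact check_of_cyclesHaveChord (G' := G.deleteEdge e) hc (test_edge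
          (ih _ (Finset.erase_ssubset he)
            ⟨f, Finset.mem_erase.2 ⟨fun h => hfc (h ▸ hc), hf⟩, hfc⟩))
      · exact check_of_not_cyclesHaveChord (G' := G.deleteEdge e) hc
    | edgeEnd =>
      obtain ⟨f, hf, -⟩ := h
      exact absurd hf (Finset.notMem_empty _)

theorem start_of_glueOuter {b : Bool} (h : RunsTo G (.glueOuter .main G.forget G.X G.X) b) :
    RunsTo G .start b := by
  refine .step ⟨_, .init⟩ fun t ht => ?_
  cases ht
  exact h

theorem start_true (h : G.IsTwoChordal) : RunsTo G .start true := by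
  obtain ⟨h, hE⟩ := BiGraph.isTwoChordal_iff.1 h
  exact start_of_glueOuter (check_of_cyclesHaveChord h (test_main (edgeHead_of_forall _ hE)))

theorem start_false (h : ¬ G.IsTwoChordal) : RunsTo G .start false := by
  apply start_of_glueOuter
  by_cases hc : CyclesHaveChord G.toSimpleGraph
  · refine check_of_cyclesHaveChord hc (test_main (edgeHead_of_exists _ ?_))
    by_contra! hE
    exact h (BiGraph.isTwoChordal_iff.2 ⟨hc, hE⟩)
  · exact check_of_not_cyclesHaveChord hc

end RunsTo

end TwoChordal

theorem theorem3p2 {V : Type*} [DecidableEq V] (G : TwoChordal.BiGraph V) :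
    TwoChordal.Halts G ∧
      (TwoChordal.Returns G true ↔ G.IsTwoChordal) ∧
      (TwoChordal.Returns G false ↔ ¬ G.IsTwoChordal) := by
  by_cases h : G.IsTwoChordal
  · have hr := TwoChordal.RunsTo.start_true h
    exact ⟨hr.halts, by simp [hr.returns_iff, h], by simp [hr.returns_iff, h]⟩
  · have hr := TwoChordal.RunsTo.start_false h
    exact ⟨hr.halts, by simp [hr.returns_iff, h], by simp [hr.returns_iff, h]⟩
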